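/- An influence graph $G=(V,E,(p_{uv})_{(u,v)\in E})$ is a finite directed graph with activation probabilities $p_{uv}\in[0,1]$. Its live-edge graph $L$ is the random subgraph that contains each edge $(u,v)\in E$ independently with probability $p_{uv}$. Let $R(S,L)$ be the set of nodes reachable in $L$ from $S\subseteq V$, and let $\sigma(S)=\mathbb{E}_L[|R(S,L)|]$. The optimal non-adaptive value is $OPT_N(G,k)=\max_{|S|=k}\sigma(S)$. An adaptive policy $\pi$ (with full-adoption feedback) selects seeds one at a time. Starting from $\psi=\emptyset$, as long as $\pi(\psi)$ is a node $v$ (and not STOP), $v$ is selected and the pair $(v,R(\{v\},L))$ is added to the observed partial realisation $\psi$. Write $|\pi|=k$ if for every live-edge graph $L$ the run ends with exactly $k$ selected seeds. Let $\sigma(\pi)$ be the expected number of nodes reached from the selected seeds, and let $OPT_A(G,k)=\max_{|\pi|=k}\sigma(\pi)$. An in-arborescence is an influence graph whose edges are exactly the pairs $(v,u)$ such that $u$ is the father of $v$ in some rooted tree on $V$ (the activation probabilities are arbitrary). Let $\mathcal{G}$ be the class of all in-arborescences, and let $$AG(\mathcal{G},k)=\sup_{G\in\mathcal{G},\ |V(G)|\ge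 k}\frac{OPT_A(G,k)}{OPT_N(G,k)}$$ be its $k$-adaptivity gap. **Theorem.** For every integer $k\ge 2$, $$AG(\mathcal{G},k)\le\frac{2}{1-(1-2/k)^k}\le\frac{2e^2}{e^2-1},$$ where $\left|\frac{2e^2}{e^2-1}-2.31\right|<0.005$ and $\frac{2e^2}{e^2-1}<\frac{2e}{e-1}$. -/

import Mathlib

universe u

/-- An influence graph `G = (V, E, (p_e)_{e ∈ E})`: a finite set `E` of directed edges `(u, v)`
and an activation probability in `[0, 1]` for every edge. -/
structure InfluenceGraph (V : Type u) where
  E : Finset (V × V)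
  p : E → unitInterval

namespace InfluenceGraph

noncomputable section

open scoped Classical

variable {V : Type u}

/-- The possible live-edge graphs of `G`, given by their sets of edges. -/
abbrev LiveEdgeGraph (G : InfluenceGraph V) : Type u := Finset G.E

/-- The probability of the live-edge graph `L`, when each edge `e` is included with probability
`p e`, independently of the other edges. -/
def liveProb (G : InfluenceGraph V) (L : G.LiveEdgeGraph) : ℝ :=
  ∏ e : G.E, if e ∈ L then (G.p e : ℝ) else 1 - (G.p e : ℝ)

/-- The expected value `𝔼_L[X(L)]` over the random live-edge graph. -/
def expect (G : InfluenceGraph V) (X : G.LiveEdgeGraph → ℝ) : ℝ :=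
  ∑ L : G.LiveEdgeGraph, G.liveProb L * X L

/-- `(u, v)` is an edge of the live-edge graph `L`. -/
def LiveAdj (G : InfluenceGraph V) (L : G.LiveEdgeGraph) (u v : V) : Prop :=
  ∃ h : (u, v) ∈ G.E, (⟨(u, v), h⟩ : G.E) ∈ L

variable [Fintype V]

/-- `R(S, L)`: the nodes reachable in `L` from some node of `S` (paths of length `0` included). -/
def reach (G : InfluenceGraph V) (S : Finset V) (L : G.LiveEdgeGraph) : Finset V :=
  Finset.univ.filter fun v => ∃ u ∈ S, Relation.ReflTransGen (G.LiveAdj L) u v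

/-- The expected influence spread `σ(S) = 𝔼_L[|R(S, L)|]` of a set of seeds. -/
def spread (G : InfluenceGraph V) (S : Finset V) : ℝ :=
  G.expect fun L => ((G.reach S L).card : ℝ)

/-- The optimal value of the non-adaptive problem: the largest `σ(S)` with `|S| = k`. -/
def optN (G : InfluenceGraph V) (k : ℕ) : ℝ :=
  ⨆ S : {S : Finset V // S.card = k}, G.spread S.1

/-- The realisation `φ_L`, `φ_L(v) = R({v}, L)`. -/
def realisation (G : InfluenceGraph V) (L : G.LiveEdgeGraph) (v : V) : Finset V :=
  G.reach {v} L

/-- The restriction of `φ_L` to `S`, as a partial function (`none` outside `S`). -/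
def restriction (G : InfluenceGraph V) (L : G.LiveEdgeGraph) (S : Finset V) :
    V → Option (Finset V) :=
  fun v => if v ∈ S then some (G.realisation L v) else none

/-- Partial realisations: the partial functions that are restrictions of some `φ_L`. -/
def PartialRealisation (G : InfluenceGraph V) : Type u :=
  {ψ : V → Option (Finset V) // ∃ L S, ψ = G.restriction L S}

/-- The restriction of `φ_L` to `S`, as a partial realisation. -/
def observe (G : InfluenceGraph V) (L : G.LiveEdgeGraph) (S : Finset V) :
    G.PartialRealisation :=
  ⟨G.restriction L S, L, S, rfl⟩

/-- `dom(ψ)`. -/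
def PartialRealisation.dom {G : InfluenceGraph V} (ψ : G.PartialRealisation) : Finset V :=
  Finset.univ.filter fun v => (ψ.1 v).isSome

/-- `R(ψ) = ⋃_{v ∈ dom ψ} ψ(v)`. -/
def PartialRealisation.reached {G : InfluenceGraph V} (ψ : G.PartialRealisation) : Finset V :=
  Finset.univ.filter fun w => ∃ v A, ψ.1 v = some A ∧ w ∈ A

/-- `f(ψ) = |R(ψ)|`. -/
def PartialRealisation.f {G : InfluenceGraph V} (ψ : G.PartialRealisation) : ℕ :=
  ψ.reached.card

/-- An adaptive policy with full-adoption feedback: it maps a partial realisation to the next seed,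
or to `none`, which stands for `STOP`. -/
abbrev Policy (G : InfluenceGraph V) : Type u := G.PartialRealisation → Option V

/-- Observing one more seed `v` adds the pair `(v, R({v}, L))` to the partial realisation. -/
theorem observe_insert (G : InfluenceGraph V) (L : G.LiveEdgeGraph) (S : Finset V) (v : V) :
    (G.observe L (insert v S)).1 =
      Function.update (G.observe L S).1 v (some (G.reach {v} L)) := by
  funext w
  by_cases h : w = v
  · subst h
    simp [observe, restriction, realisation]
  · simp [observe, restriction, realisation, h]

/-- One iteration of the loop that runs the policy `π` on the live-edge graph `L`. The current
partial realisation is always the restriction of `φ_L` to the set of seeds selected so far, so the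
loop keeps track of this set; nothing changes any more once `π` has returned `STOP`. -/
def Policy.step {G : InfluenceGraph V} (π : G.Policy) (L : G.LiveEdgeGraph) (S : Finset V) :
    Finset V :=
  match π (G.observe L S) with
  | none => S
  | some v => insert v S

/-- The partial realisation `ψ_{π,L}` that is obtained by running `π` on `L`. While the loop goes
on, each iteration must select a new seed (otherwise the partial realisation does not change and
the loop never ends), so a run that ends has at most `|V|` iterations. -/
def Policy.output {G : InfluenceGraph V} (π : G.Policy) (L : G.LiveEdgeGraph) :
    G.PartialRealisation :=
  G.observe L ((π.step L)^[Fintype.card V] ∅)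

/-- `|π| = k`: on every live-edge graph the run of `π` ends (`π` returns `STOP`), and the partial
realisation returned has a domain of exactly `k` seeds. -/
def Policy.HasSize {G : InfluenceGraph V} (π : G.Policy) (k : ℕ) : Prop :=
  ∀ L : G.LiveEdgeGraph, π (π.output L) = none ∧ (π.output L).dom.card = k

/-- The expected influence spread `σ(π) = 𝔼_L[f(ψ_{π,L})]` of a policy. -/
def Policy.spread {G : InfluenceGraph V} (π : G.Policy) : ℝ :=
  G.expect fun L => ((π.output L).f : ℝ)

/-- The optimal value of the adaptive problem: the largest `σ(π)` with `|π| = k`. -/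
def optA (G : InfluenceGraph V) (k : ℕ) : ℝ :=
  ⨆ π : {π : G.Policy // π.HasSize k}, Policy.spread π.1

end

end InfluenceGraph

/-- The class of in-arborescences: for some tree `T` on the node set, rooted at `r`, the edges are
exactly the pairs `(v, u)` such that `u` is the father of `v`, i.e. the neighbour of `v` in `T` that
is closer to `r`. The activation probabilities are arbitrary. -/
def inArborescences (V : Type u) : Set (InfluenceGraph V) :=
  {G | ∃ (T : SimpleGraph V) (r : V), T.IsTree ∧
    ∀ v u : V, (v, u) ∈ G.E ↔ T.Adj v u ∧ T.dist r v = T.dist r u + 1}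

/-- The `k`-adaptivity gap of a class `C` of influence graphs: the supremum, in the extended reals,
of `OPT_A(G, k) / OPT_N(G, k)` over the graphs `G` of the class on finite node sets with at least
`k` nodes (with fewer nodes neither problem has a feasible solution). -/
noncomputable def kAdaptivityGap (C : ∀ V : Type u, Set (InfluenceGraph V)) (k : ℕ) : EReal :=
  ⨆ (V : Type u) (_ : Fintype V) (G : InfluenceGraph V) (_ : G ∈ C V) (_ : k ≤ Fintype.card V),
    ((G.optA k / G.optN k : ℝ) : EReal)

/-! An in-arborescence enters only through out-degree at most one. Let N_t be the non-adaptive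
optimum for t seeds, attained by S, and let π be a policy of size k. The heart is
`Policy.HasSize.spread_le`: σ(π) ≤ 2 N_t + k (N_{t+1} - N_t).

Run π on L and S on an independent copy L'. The nodes reached by π fall into three groups. Those in
R(S, L') number at most N_t on average. Those reached in L from the boundary of R(S, L') also do:
the boundary has at most t nodes (`card_boundary_le`) and is independent of L. To any other node
newly reached by a seed of π, the path in L avoids all edges leaving the nodes already reached by π
in L or by S in L'. It therefore survives the exchange of the remaining edges between L and L'
(`reach_sdiff_subset_reach_mix`), which preserves the joint law (`expect_expect_mix`). After the
exchange the seed is independent of the graph on which its gain over S is measured, so it gains at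
most N_{t+1} - N_t; π has k seeds.

Hence σ(π)/2 - N_t shrinks by the factor 1 - 2/k with each t, and k steps give the bound. -/

namespace InfluenceGraph

noncomputable section

open scoped Classical

variable {V : Type u}

/-! ### Expectations over live-edge graphs and the exchange of edges -/

section Expectation

variable (G : InfluenceGraph V)

theorem liveProb_nonneg (L : G.LiveEdgeGraph) : 0 ≤ G.liveProb L := by
  refine Finset.prod_nonneg fun e _ => ?_
  split_ifs
  · exact (G.p e).2.1
  · linarith [(G.p e).2.2]

/-- Expand ∏ (p_e + (1 - p_e)) = 1 over the subsets of edges. -/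
theorem sum_liveProb : ∑ L : G.LiveEdgeGraph, G.liveProb L = 1 := by
  have h := Finset.prod_add (fun e : G.E => (G.p e : ℝ)) (fun e => 1 - (G.p e : ℝ)) Finset.univ
  simp only [add_sub_cancel, Finset.prod_const_one, Finset.powerset_univ] at h
  rw [h]
  refine Finset.sum_congr rfl fun L _ => ?_
  rw [liveProb, Finset.prod_ite]
  congr 1 <;> refine Finset.prod_congr ?_ fun _ _ => rfl <;> ext e <;> simp

variable {G}

theorem expect_mono {X Y : G.LiveEdgeGraph → ℝ} (h : ∀ L, X L ≤ Y L) :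
    G.expect X ≤ G.expect Y :=
  Finset.sum_le_sum fun L _ => mul_le_mul_of_nonneg_left (h L) (G.liveProb_nonneg L)

theorem expect_const (c : ℝ) : G.expect (fun _ => c) = c := by
  rw [expect, ← Finset.sum_mul, sum_liveProb, one_mul]

theorem expect_add (X Y : G.LiveEdgeGraph → ℝ) :
    G.expect (fun L => X L + Y L) = G.expect X + G.expect Y := by
  simp only [expect, mul_add, Finset.sum_add_distrib]

theorem expect_sub (X Y : G.LiveEdgeGraph → ℝ) :
    G.expect (fun L => X L - Y L) = G.expect X - G.expect Y := by
  simp only [expect, mul_sub, Finset.sum_sub_distrib]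

theorem expect_mul_const (X : G.LiveEdgeGraph → ℝ) (c : ℝ) :
    G.expect (fun L => X L * c) = G.expect X * c := by
  simp only [expect, Finset.sum_mul, mul_assoc]

theorem expect_sum {ι : Type*} (s : Finset ι) (X : ι → G.LiveEdgeGraph → ℝ) :
    G.expect (fun L => ∑ i ∈ s, X i L) = ∑ i ∈ s, G.expect (X i) := by
  simp only [expect, Finset.mul_sum]
  exact Finset.sum_comm

theorem expect_comm (X : G.LiveEdgeGraph → G.LiveEdgeGraph → ℝ) :
    G.expect (fun L => G.expect fun L' => X L L') =
      G.expect (fun L' => G.expect fun L => X L L') := by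
  simp only [expect, Finset.mul_sum]
  rw [Finset.sum_comm]
  refine Finset.sum_congr rfl fun _ _ => Finset.sum_congr rfl fun _ _ => ?_
  ring

theorem expect_expect_eq_sum (X : G.LiveEdgeGraph → G.LiveEdgeGraph → ℝ) :
    G.expect (fun L => G.expect fun L' => X L L') =
      ∑ q : G.LiveEdgeGraph × G.LiveEdgeGraph, G.liveProb q.1 * G.liveProb q.2 * X q.1 q.2 := by
  rw [Fintype.sum_prod_type]
  simp only [expect, Finset.mul_sum, mul_assoc]

/-- The live-edge graph that agrees with `L` on the edges of `P` and with `L'` elsewhere. -/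
def mix (P : Finset G.E) (L L' : G.LiveEdgeGraph) : G.LiveEdgeGraph :=
  Finset.univ.filter fun e => if e ∈ P then e ∈ L else e ∈ L'

theorem mem_mix_of_mem {P : Finset G.E} {L L' : G.LiveEdgeGraph} {e : G.E} (h : e ∈ P) :
    e ∈ mix P L L' ↔ e ∈ L := by
  simp [mix, h]

theorem mem_mix_of_notMem {P : Finset G.E} {L L' : G.LiveEdgeGraph} {e : G.E} (h : e ∉ P) :
    e ∈ mix P L L' ↔ e ∈ L' := by
  simp [mix, h]

theorem mix_mix (P : Finset G.E) (L L' : G.LiveEdgeGraph) :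
    mix P (mix P L L') (mix P L' L) = L := by
  ext e
  by_cases h : e ∈ P <;> simp [mix, h]

/-- Edge by edge, the two factors are either kept or swapped. -/
theorem liveProb_mix_mul (P : Finset G.E) (L L' : G.LiveEdgeGraph) :
    G.liveProb (mix P L L') * G.liveProb (mix P L' L) = G.liveProb L * G.liveProb L' := by
  simp only [liveProb, ← Finset.prod_mul_distrib]
  refine Finset.prod_congr rfl fun e _ => ?_
  by_cases h : e ∈ P
  · simp only [mem_mix_of_mem h]
  · simp only [mem_mix_of_notMem h, mul_comm]

/-- Exchanging the edges outside a set `P` between two independent live-edge graphs does not change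
the expectation, provided that the exchange does not change `P` itself. -/
theorem expect_expect_mix (P : G.LiveEdgeGraph → G.LiveEdgeGraph → Finset G.E)
    (hP : ∀ L L', P (mix (P L L') L L') (mix (P L L') L' L) = P L L')
    (X : G.LiveEdgeGraph → G.LiveEdgeGraph → ℝ) :
    G.expect (fun L => G.expect fun L' => X (mix (P L L') L L') (mix (P L L') L' L)) =
      G.expect (fun L => G.expect fun L' => X L L') := by
  rw [expect_expect_eq_sum, expect_expect_eq_sum]
  let swap : G.LiveEdgeGraph × G.LiveEdgeGraph → G.LiveEdgeGraph × G.LiveEdgeGraph :=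
    fun q => (mix (P q.1 q.2) q.1 q.2, mix (P q.1 q.2) q.2 q.1)
  have hswap : Function.Involutive swap := fun q => by
    simp only [swap, hP, mix_mix]
  refine Fintype.sum_equiv hswap.toPerm _ _ fun q => ?_
  simp only [Function.Involutive.coe_toPerm, swap, liveProb_mix_mul]

end Expectation

/-! ### Reachability and the boundary of a reached set -/

section Reach

variable {G : InfluenceGraph V}

variable (G) in
/-- The edges of `G` that leave a node of `A`. -/
def outEdges (A : Finset V) : Finset G.E :=
  Finset.univ.filter fun e => e.1.1 ∈ A

theorem mem_outEdges {A : Finset V} {e : G.E} : e ∈ G.outEdges A ↔ e.1.1 ∈ A := by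
  simp [outEdges]

variable [Fintype V]

theorem mem_reach {S : Finset V} {L : G.LiveEdgeGraph} {w : V} :
    w ∈ G.reach S L ↔ ∃ s ∈ S, Relation.ReflTransGen (G.LiveAdj L) s w := by
  simp [reach]

theorem reach_mono {S T : Finset V} (h : S ⊆ T) (L : G.LiveEdgeGraph) :
    G.reach S L ⊆ G.reach T L := fun w hw => by
  obtain ⟨s, hs, hsw⟩ := mem_reach.1 hw
  exact mem_reach.2 ⟨s, h hs, hsw⟩

theorem reach_union (S T : Finset V) (L : G.LiveEdgeGraph) :
    G.reach (S ∪ T) L = G.reach S L ∪ G.reach T L := by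
  ext w
  simp only [mem_reach, Finset.mem_union, or_and_right, exists_or]

theorem reach_empty (L : G.LiveEdgeGraph) : G.reach ∅ L = ∅ := by
  ext w
  simp [mem_reach]

theorem mem_reach_of_reflTransGen {S : Finset V} {L : G.LiveEdgeGraph} {a w : V}
    (ha : a ∈ G.reach S L) (h : Relation.ReflTransGen (G.LiveAdj L) a w) : w ∈ G.reach S L := by
  obtain ⟨s, hs, hsa⟩ := mem_reach.1 ha
  exact mem_reach.2 ⟨s, hs, hsa.trans h⟩

/-- The nodes reachable from a set are determined by the states of the edges that leave them. -/
theorem reach_eq_of_agree {S : Finset V} {L L' : G.LiveEdgeGraph}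
    (h : ∀ e ∈ G.outEdges (G.reach S L), e ∈ L' ↔ e ∈ L) : G.reach S L' = G.reach S L := by
  have key : ∀ s ∈ S, ∀ w, Relation.ReflTransGen (G.LiveAdj L') s w ↔
      Relation.ReflTransGen (G.LiveAdj L) s w := by
    refine fun s hs w => ⟨fun hw => ?_, fun hw => ?_⟩
    · induction hw with
      | refl => exact .refl
      | tail _ hab ih =>
        obtain ⟨he, hm⟩ := hab
        exact ih.tail ⟨he, (h _ (mem_outEdges.2 (mem_reach.2 ⟨s, hs, ih⟩))).1 hm⟩
    · induction hw with
      | refl => exact .refl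
      | tail ha hab ih =>
        obtain ⟨he, hm⟩ := hab
        exact ih.tail ⟨he, (h _ (mem_outEdges.2 (mem_reach.2 ⟨s, hs, ha⟩))).2 hm⟩
  ext w
  simp only [mem_reach]
  exact exists_congr fun s => and_congr_right fun hs => key s hs w

variable (G) in
/-- The heads of the edges that leave `R(S, L)` and are not in `L`. -/
def boundary (S : Finset V) (L : G.LiveEdgeGraph) : Finset V :=
  Finset.univ.filter fun b => ∃ a ∈ G.reach S L, (a, b) ∈ G.E ∧ ¬ G.LiveAdj L a b

theorem mem_boundary {S : Finset V} {L : G.LiveEdgeGraph} {b : V} :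
    b ∈ G.boundary S L ↔ ∃ a ∈ G.reach S L, (a, b) ∈ G.E ∧ ¬ G.LiveAdj L a b := by
  simp [boundary]

/-- If every node has at most one outgoing edge, every seed contributes at most one node to the
boundary. -/
theorem card_boundary_le (hG : ∀ a b c : V, (a, b) ∈ G.E → (a, c) ∈ G.E → b = c)
    (S : Finset V) (L : G.LiveEdgeGraph) : (G.boundary S L).card ≤ S.card := by
  have hex : ∀ b ∈ G.boundary S L, ∃ s, s ∈ S ∧ ∃ a,
      Relation.ReflTransGen (G.LiveAdj L) s a ∧ (a, b) ∈ G.E ∧ ¬ G.LiveAdj L a b := by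
    intro b hb
    obtain ⟨a, ha, he, hn⟩ := mem_boundary.1 hb
    obtain ⟨s, hs, hsa⟩ := mem_reach.1 ha
    exact ⟨s, hs, a, hsa, he, hn⟩
  choose! f hfS hf using hex
  -- The only edge out of `a` is dead, so every live walk from `a` stops there.
  have hdead : ∀ {a a' b}, (a, b) ∈ G.E → ¬ G.LiveAdj L a b →
      Relation.ReflTransGen (G.LiveAdj L) a a' → a = a' := by
    intro a a' b he hn h
    rcases h.cases_head with h | ⟨c, hac, _⟩
    · exact h
    · obtain rfl := hG a b c he hac.1
      exact absurd hac hn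
  refine Finset.card_le_card_of_injOn f hfS fun b hb c hc hbc => ?_
  obtain ⟨a, hsa, hab, hn⟩ := hf b hb
  obtain ⟨a', hsa', hac, hn'⟩ := hf c hc
  rw [← hbc] at hsa'
  -- Live walks from one seed never branch, so one of `a`, `a'` is reachable from the other.
  have hu : Relator.RightUnique (G.LiveAdj L) := fun x y z hy hz => hG x y z hy.1 hz.1
  have haa : a = a' := by
    rcases hsa.total_of_right_unique hu hsa' with h | h
    · exact hdead hab hn h
    · exact (hdead hac hn' h).symm
  subst haa
  exact hG a b c hab hac

/-- Walking along `L` from a node of `R(S, L')` one stays in `R(S, L')`, or passes through the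
boundary. -/
theorem mem_reach_or_mem_reach_boundary {S : Finset V} {L L' : G.LiveEdgeGraph} {a w : V}
    (h : Relation.ReflTransGen (G.LiveAdj L) a w) (ha : a ∈ G.reach S L') :
    w ∈ G.reach S L' ∨ w ∈ G.reach (G.boundary S L') L := by
  induction h using Relation.ReflTransGen.head_induction_on with
  | refl => exact .inl ha
  | head hac hcw ih =>
    rename_i a c
    by_cases hl : G.LiveAdj L' a c
    · exact ih (mem_reach_of_reflTransGen ha (.single hl))
    · exact .inr (mem_reach.2 ⟨c, mem_boundary.2 ⟨a, ha, hac.1, hl⟩, hcw⟩)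

/-- The nodes reached from `T` in `L`, but neither from `U` in `L` nor from `S` in `L'`, nor through
the boundary of the latter, are still reached once the edges that leave `R(U, L)` and `R(S, L')`
have been replaced by those of `L'`. -/
theorem reach_sdiff_subset_reach_mix (S T U : Finset V) (L L' : G.LiveEdgeGraph) :
    (G.reach T L \ G.reach U L) \ (G.reach S L' ∪ G.reach (G.boundary S L') L) ⊆
      G.reach T (mix (G.outEdges (G.reach U L ∪ G.reach S L')) L' L) \
        G.reach S (mix (G.outEdges (G.reach U L ∪ G.reach S L')) L' L) := by
  intro w hw
  simp only [Finset.mem_sdiff, Finset.mem_union, not_or] at hw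
  obtain ⟨⟨hT, hU⟩, hS, hB⟩ := hw
  have hagree : G.reach S (mix (G.outEdges (G.reach U L ∪ G.reach S L')) L' L) =
      G.reach S L' := by
    refine reach_eq_of_agree fun e he => mem_mix_of_mem ?_
    exact mem_outEdges.2 (Finset.mem_union_right _ (mem_outEdges.1 he))
  rw [hagree]
  refine Finset.mem_sdiff.2 ⟨?_, hS⟩
  obtain ⟨v, hv, hvw⟩ := mem_reach.1 hT
  refine mem_reach.2 ⟨v, hv, ?_⟩
  clear hv hT
  induction hvw using Relation.ReflTransGen.head_induction_on with
  | refl => exact .refl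
  | head hac hcw ih =>
    rename_i a c
    refine .head ?_ ih
    obtain ⟨he, hm⟩ := hac
    -- If the edge left one of the two reached sets, the rest of the walk would put `w` into an
    -- excluded set.
    refine ⟨he, (mem_mix_of_notMem fun hmem => ?_).2 hm⟩
    have haw := Relation.ReflTransGen.head (⟨he, hm⟩ : G.LiveAdj L a c) hcw
    rcases Finset.mem_union.1 (mem_outEdges.1 hmem) with h | h
    · exact hU (mem_reach_of_reflTransGen h haw)
    · rcases mem_reach_or_mem_reach_boundary haw h with h | h
      · exact hS h
      · exact hB h

end Reach

/-! ### Non-adaptive spread and marginal gains -/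

section Spread

variable [Fintype V] {G : InfluenceGraph V}

theorem spread_mono {S T : Finset V} (h : S ⊆ T) : G.spread S ≤ G.spread T :=
  expect_mono fun L => by exact_mod_cast Finset.card_le_card (reach_mono h L)

theorem bddAbove_range_spread (t : ℕ) :
    BddAbove (Set.range fun S : {S : Finset V // S.card = t} => G.spread S.1) :=
  (Set.finite_range _).bddAbove

theorem spread_le_optN {S : Finset V} {t : ℕ} (hS : S.card ≤ t) (ht : t ≤ Fintype.card V) :
    G.spread S ≤ G.optN t := by
  obtain ⟨T, hST, -, hT⟩ := Finset.exists_subsuperset_card_eq (Finset.subset_univ S) hS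
    (by simpa using ht)
  exact (spread_mono hST).trans (le_ciSup (bddAbove_range_spread t) ⟨T, hT⟩)

theorem exists_spread_eq_optN {t : ℕ} (ht : t ≤ Fintype.card V) :
    ∃ S : Finset V, S.card = t ∧ G.spread S = G.optN t := by
  obtain ⟨T, -, hT⟩ := Finset.exists_subset_card_eq
    (show t ≤ (Finset.univ : Finset V).card by simpa using ht)
  have : Nonempty {S : Finset V // S.card = t} := ⟨⟨T, hT⟩⟩
  obtain ⟨S, hS⟩ := exists_eq_ciSup_of_finite (f := fun S : {S : Finset V // S.card = t} =>
    G.spread S.1)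
  exact ⟨S.1, S.2, hS⟩

theorem optN_nonneg (G : InfluenceGraph V) (t : ℕ) : 0 ≤ G.optN t :=
  Real.iSup_nonneg fun _ =>
    Finset.sum_nonneg fun L _ => mul_nonneg (G.liveProb_nonneg L) (Nat.cast_nonneg _)

theorem expect_card_reach_sdiff (S T : Finset V) :
    G.expect (fun L => ((G.reach T L \ G.reach S L).card : ℝ)) =
      G.spread (S ∪ T) - G.spread S := by
  rw [spread, spread, ← expect_sub]
  congr 1
  funext L
  rw [reach_union, ← Finset.union_sdiff_self_eq_union,
    Finset.card_union_of_disjoint Finset.disjoint_sdiff]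
  push_cast
  ring

/-- The marginal gain of at most one further seed over an optimal set of `t` seeds. -/
theorem expect_card_reach_sdiff_le {S T : Finset V} {t : ℕ} (hS : S.card = t)
    (hopt : G.spread S = G.optN t) (ht : t + 1 ≤ Fintype.card V) (hT : T.card ≤ 1) :
    G.expect (fun L => ((G.reach T L \ G.reach S L).card : ℝ)) ≤
      T.card * (G.optN (t + 1) - G.optN t) := by
  rw [expect_card_reach_sdiff, hopt]
  rcases Nat.le_one_iff_eq_zero_or_eq_one.1 hT with h | h
  · rw [Finset.card_eq_zero.1 h]
    simp [hopt]
  · have := spread_le_optN (G := G) ((Finset.card_union_le S T).trans (by omega)) ht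
    rw [h]
    push_cast
    linarith

end Spread

/-! ### Adaptive policies and the recursion -/

section Policy

variable [Fintype V] {G : InfluenceGraph V}

/-- The seeds selected by `π` in the first `i` iterations on `L`. -/
def Policy.seeds (π : G.Policy) (L : G.LiveEdgeGraph) (i : ℕ) : Finset V :=
  (π.step L)^[i] ∅

theorem Policy.seeds_succ (π : G.Policy) (L : G.LiveEdgeGraph) (i : ℕ) :
    π.seeds L (i + 1) = π.step L (π.seeds L i) :=
  Function.iterate_succ_apply' _ _ _

theorem Policy.subset_step (π : G.Policy) (L : G.LiveEdgeGraph) (S : Finset V) :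
    S ⊆ π.step L S := by
  unfold Policy.step
  split
  · exact subset_rfl
  · exact Finset.subset_insert _ _

theorem Policy.card_step_sdiff_le (π : G.Policy) (L : G.LiveEdgeGraph) (S : Finset V) :
    (π.step L S \ S).card ≤ 1 := by
  unfold Policy.step
  split
  · simp
  · rename_i v _
    refine (Finset.card_le_card (t := {v}) ?_).trans (by simp)
    intro w hw
    simp only [Finset.mem_sdiff, Finset.mem_insert] at hw
    simpa using hw.1.resolve_right hw.2

theorem Policy.seeds_subset_succ (π : G.Policy) (L : G.LiveEdgeGraph) (i : ℕ) :
    π.seeds L i ⊆ π.seeds L (i + 1) := by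
  rw [π.seeds_succ]
  exact π.subset_step L _

/-- The policy sees only the sets reached from the seeds in `S`, and these depend only on edges
leaving `R(S, L)`. -/
theorem Policy.step_eq_of_agree (π : G.Policy) {L L' : G.LiveEdgeGraph} {S : Finset V}
    (h : ∀ e ∈ G.outEdges (G.reach S L), e ∈ L' ↔ e ∈ L) : π.step L' S = π.step L S := by
  have hobs : G.observe L' S = G.observe L S := by
    refine Subtype.ext (funext fun v => ?_)
    simp only [observe, restriction, realisation]
    split_ifs with hv
    · rw [reach_eq_of_agree fun e he => h e (mem_outEdges.2
        (reach_mono (Finset.singleton_subset_iff.2 hv) L (mem_outEdges.1 he)))]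
    · rfl
  rw [Policy.step, Policy.step, hobs]

/-- The first `i` seeds are determined by the states of the edges observed by then. -/
theorem Policy.seeds_eq_of_agree (π : G.Policy) {L L' : G.LiveEdgeGraph} {i : ℕ}
    (h : ∀ e ∈ G.outEdges (G.reach (π.seeds L i) L), e ∈ L' ↔ e ∈ L) :
    π.seeds L' i = π.seeds L i := by
  induction i with
  | zero => rfl
  | succ i ih =>
    have h' : ∀ e ∈ G.outEdges (G.reach (π.seeds L i) L), e ∈ L' ↔ e ∈ L := fun e he =>
      h e (mem_outEdges.2 (reach_mono (π.seeds_subset_succ L i) L (mem_outEdges.1 he)))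
    rw [π.seeds_succ, π.seeds_succ, ih h', π.step_eq_of_agree h']

/-- The seeds selected by `π` in iteration `i` on `L`: at most one. -/
def Policy.newSeeds (π : G.Policy) (L : G.LiveEdgeGraph) (i : ℕ) : Finset V :=
  π.seeds L (i + 1) \ π.seeds L i

theorem Policy.card_newSeeds_le (π : G.Policy) (L : G.LiveEdgeGraph) (i : ℕ) :
    (π.newSeeds L i).card ≤ 1 := by
  rw [Policy.newSeeds, π.seeds_succ]
  exact π.card_step_sdiff_le L _

theorem Policy.newSeeds_eq_of_agree (π : G.Policy) {L L' : G.LiveEdgeGraph} {i : ℕ}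
    (h : ∀ e ∈ G.outEdges (G.reach (π.seeds L i) L), e ∈ L' ↔ e ∈ L) :
    π.newSeeds L' i = π.newSeeds L i := by
  rw [Policy.newSeeds, Policy.newSeeds, π.seeds_succ, π.seeds_succ, π.seeds_eq_of_agree h,
    π.step_eq_of_agree h]

theorem Policy.sum_card_newSeeds (π : G.Policy) (L : G.LiveEdgeGraph) (n : ℕ) :
    ∑ i ∈ Finset.range n, (π.newSeeds L i).card = (π.seeds L n).card := by
  induction n with
  | zero => rfl
  | succ n ih =>
    rw [Finset.sum_range_succ, ih, Policy.newSeeds, add_comm,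
      Finset.card_sdiff_add_card_eq_card (π.seeds_subset_succ L n)]

theorem Policy.card_reach_seeds_le (π : G.Policy) (L : G.LiveEdgeGraph) (Q : Finset V) (n : ℕ) :
    (G.reach (π.seeds L n) L).card ≤ Q.card + ∑ i ∈ Finset.range n,
      ((G.reach (π.newSeeds L i) L \ G.reach (π.seeds L i) L) \ Q).card := by
  have hsub : G.reach (π.seeds L n) L ⊆ Q ∪ (Finset.range n).biUnion fun i =>
      (G.reach (π.newSeeds L i) L \ G.reach (π.seeds L i) L) \ Q := by
    induction n with
    | zero =>
      rw [show π.seeds L 0 = ∅ from rfl, reach_empty]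
      exact Finset.empty_subset _
    | succ n ih =>
      rw [← Finset.sdiff_union_of_subset (π.seeds_subset_succ L n), reach_union]
      intro w hw
      rw [Finset.range_add_one, Finset.biUnion_insert]
      by_cases h : w ∈ G.reach (π.seeds L n) L
      · have := ih h
        simp only [Finset.mem_union] at this ⊢
        tauto
      · have : w ∈ G.reach (π.newSeeds L n) L := by
          simpa [h, Policy.newSeeds] using hw
        simp only [Finset.mem_union, Finset.mem_sdiff]
        tauto
  exact (Finset.card_le_card hsub).trans ((Finset.card_union_le _ _).trans
    (Nat.add_le_add_left Finset.card_biUnion_le _))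

theorem dom_observe (L : G.LiveEdgeGraph) (S : Finset V) : (G.observe L S).dom = S := by
  ext v
  by_cases h : v ∈ S <;> simp [PartialRealisation.dom, observe, restriction, h]

theorem reached_observe (L : G.LiveEdgeGraph) (S : Finset V) :
    (G.observe L S).reached = G.reach S L := by
  ext w
  simp [PartialRealisation.reached, observe, restriction, realisation, mem_reach]

/-- On average, iteration `i` of an adaptive policy gains no more over the non-adaptive seeds and
their boundary than a seed that is chosen independently of the live-edge graph gains over the
non-adaptive seeds. -/
theorem Policy.expect_card_gain_le (π : G.Policy) (S : Finset V) (i : ℕ) :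
    G.expect (fun L => G.expect fun L' =>
      (((G.reach (π.newSeeds L i) L \ G.reach (π.seeds L i) L) \
        (G.reach S L' ∪ G.reach (G.boundary S L') L)).card : ℝ)) ≤
    G.expect (fun L => G.expect fun L' =>
      ((G.reach (π.newSeeds L i) L' \ G.reach S L').card : ℝ)) := by
  let P : G.LiveEdgeGraph → G.LiveEdgeGraph → Finset G.E := fun L L' =>
    G.outEdges (G.reach (π.seeds L i) L ∪ G.reach S L')
  have hleft : ∀ L L', ∀ e ∈ G.outEdges (G.reach (π.seeds L i) L),
      e ∈ mix (P L L') L L' ↔ e ∈ L := fun L L' e he =>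
    mem_mix_of_mem (mem_outEdges.2 (Finset.mem_union_left _ (mem_outEdges.1 he)))
  have hright : ∀ L L', ∀ e ∈ G.outEdges (G.reach S L'),
      e ∈ mix (P L L') L' L ↔ e ∈ L' := fun L L' e he =>
    mem_mix_of_mem (mem_outEdges.2 (Finset.mem_union_right _ (mem_outEdges.1 he)))
  -- Both reached sets defining `P` depend only on edges in `P`, which the exchange leaves alone.
  have hP : ∀ L L', P (mix (P L L') L L') (mix (P L L') L' L) = P L L' := fun L L' => by
    change G.outEdges _ = G.outEdges _
    rw [π.seeds_eq_of_agree (hleft L L'), reach_eq_of_agree (hleft L L'),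
      reach_eq_of_agree (hright L L')]
  rw [← expect_expect_mix P hP fun L L' =>
    ((G.reach (π.newSeeds L i) L' \ G.reach S L').card : ℝ)]
  refine expect_mono fun L => expect_mono fun L' => ?_
  rw [π.newSeeds_eq_of_agree (hleft L L')]
  exact_mod_cast Finset.card_le_card (reach_sdiff_subset_reach_mix S _ _ L L')

/-- The gain of the best further seed bounds how far an adaptive policy is ahead of twice the
non-adaptive optimum. -/
theorem Policy.HasSize.spread_le {π : G.Policy} {k t : ℕ} (hπ : π.HasSize k)
    (hG : ∀ a b c : V, (a, b) ∈ G.E → (a, c) ∈ G.E → b = c) (ht : t + 1 ≤ Fintype.card V) :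
    π.spread ≤ 2 * G.optN t + k * (G.optN (t + 1) - G.optN t) := by
  obtain ⟨S, hS, hopt⟩ := exists_spread_eq_optN (G := G) (t.le_succ.trans ht)
  have hcard : ∀ L, (π.seeds L (Fintype.card V)).card = k := fun L => by
    have := (hπ L).2
    rwa [Policy.output, dom_observe] at this
  have hboundary : G.expect (fun L' => G.spread (G.boundary S L')) ≤ G.optN t := by
    rw [← expect_const (G := G) (G.optN t)]
    exact expect_mono fun L' =>
      spread_le_optN ((card_boundary_le hG S L').trans hS.le) (t.le_succ.trans ht)
  have hgain : ∀ i, G.expect (fun L => G.expect fun L' =>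
      (((G.reach (π.newSeeds L i) L \ G.reach (π.seeds L i) L) \
        (G.reach S L' ∪ G.reach (G.boundary S L') L)).card : ℝ)) ≤
      G.expect (fun L => ((π.newSeeds L i).card : ℝ)) * (G.optN (t + 1) - G.optN t) := fun i => by
    refine (π.expect_card_gain_le S i).trans ?_
    rw [← expect_mul_const]
    exact expect_mono fun L => expect_card_reach_sdiff_le hS hopt ht (π.card_newSeeds_le L i)
  calc π.spread
      ≤ G.expect (fun L => G.expect fun L' =>
          (((G.reach S L').card : ℝ) + ((G.reach (G.boundary S L') L).card : ℝ)) +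
          ∑ i ∈ Finset.range (Fintype.card V),
            (((G.reach (π.newSeeds L i) L \ G.reach (π.seeds L i) L) \
              (G.reach S L' ∪ G.reach (G.boundary S L') L)).card : ℝ)) := by
        refine expect_mono fun L => ?_
        -- The spread of π does not involve `L'`, so it may be averaged over `L'`.
        rw [← expect_const (G := G) ((π.output L).f : ℝ)]
        refine expect_mono fun L' => ?_
        rw [PartialRealisation.f, Policy.output, reached_observe]
        exact_mod_cast (π.card_reach_seeds_le L _ _).trans
          (Nat.add_le_add_right (Finset.card_union_le _ _) _)
    _ = (G.spread S + G.expect (fun L' => G.spread (G.boundary S L'))) +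
          ∑ i ∈ Finset.range (Fintype.card V), G.expect (fun L => G.expect fun L' =>
            (((G.reach (π.newSeeds L i) L \ G.reach (π.seeds L i) L) \
              (G.reach S L' ∪ G.reach (G.boundary S L') L)).card : ℝ)) := by
        simp only [expect_add, expect_sum]
        rw [expect_comm (G := G) fun L L' => ((G.reach (G.boundary S L') L).card : ℝ),
          expect_const]
        rfl
    _ ≤ (G.optN t + G.optN t) + ∑ i ∈ Finset.range (Fintype.card V),
          G.expect (fun L => ((π.newSeeds L i).card : ℝ)) * (G.optN (t + 1) - G.optN t) :=
        add_le_add (add_le_add hopt.le hboundary) (Finset.sum_le_sum fun i _ => hgain i)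
    _ = 2 * G.optN t + k * (G.optN (t + 1) - G.optN t) := by
        rw [← Finset.sum_mul, ← expect_sum, two_mul]
        congr 2
        rw [← expect_const (G := G) (k : ℝ)]
        congr 1
        funext L
        exact_mod_cast (π.sum_card_newSeeds L _).trans (hcard L)

/-- The adaptivity gap of an influence graph in which every node has at most one outgoing edge. -/
theorem optA_div_optN_le {k : ℕ} (hk : 2 ≤ k) (hV : k ≤ Fintype.card V)
    (hG : ∀ a b c : V, (a, b) ∈ G.E → (a, c) ∈ G.E → b = c) :
    G.optA k / G.optN k ≤ 2 / (1 - (1 - 2 / (k : ℝ)) ^ k) := by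
  have hk' : (2 : ℝ) ≤ k := by exact_mod_cast hk
  have hk0 : (0 : ℝ) < k := by linarith
  -- Needs `2 ≤ k`; the induction below multiplies an inequality by this factor.
  have hb0 : 0 ≤ 1 - 2 / (k : ℝ) := by
    rw [sub_nonneg, div_le_one hk0]
    exact hk'
  have hb1 : 1 - 2 / (k : ℝ) < 1 := by linarith [div_pos two_pos hk0]
  have hpos : 0 < 1 - (1 - 2 / (k : ℝ)) ^ k := by
    linarith [pow_lt_one₀ hb0 hb1 (show k ≠ 0 by omega)]
  have hN := G.optN_nonneg k
  have hpol : ∀ π : {π : G.Policy // π.HasSize k},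
      Policy.spread π.1 ≤ 2 / (1 - (1 - 2 / (k : ℝ)) ^ k) * G.optN k := by
    intro π
    have hrec : ∀ t ≤ k, π.1.spread / 2 - G.optN t ≤
        (1 - 2 / (k : ℝ)) ^ t * (π.1.spread / 2) := by
      intro t
      induction t with
      | zero =>
        intro _
        have := G.optN_nonneg 0
        simp only [pow_zero, one_mul]
        linarith
      | succ t ih =>
        intro ht
        have h1 := π.2.spread_le hG (ht.trans hV)
        have h2 : (π.1.spread - 2 * G.optN t) / k ≤ G.optN (t + 1) - G.optN t := by
          rw [div_le_iff₀ hk0]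
          linarith
        calc π.1.spread / 2 - G.optN (t + 1)
            ≤ π.1.spread / 2 - G.optN t - (π.1.spread - 2 * G.optN t) / k := by linarith
          _ = (1 - 2 / (k : ℝ)) * (π.1.spread / 2 - G.optN t) := by ring
          _ ≤ (1 - 2 / (k : ℝ)) * ((1 - 2 / (k : ℝ)) ^ t * (π.1.spread / 2)) :=
              mul_le_mul_of_nonneg_left (ih (by omega)) hb0
          _ = (1 - 2 / (k : ℝ)) ^ (t + 1) * (π.1.spread / 2) := by ring
    have h := hrec k le_rfl
    rw [div_mul_eq_mul_div, le_div_iff₀ hpos]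
    linarith
  have hA : G.optA k ≤ 2 / (1 - (1 - 2 / (k : ℝ)) ^ k) * G.optN k :=
    -- The bound must be nonnegative because a real supremum over no policies is 0.
    Real.iSup_le hpol (mul_nonneg (div_pos two_pos hpos).le hN)
  exact div_le_of_le_mul₀ hN (div_pos two_pos hpos).le hA

end Policy

end

end InfluenceGraph

/-! ### Fathers in trees, and the numerical bounds -/

/-- In a tree rooted at `r`, a node has at most one neighbour that is closer to `r`. -/
theorem SimpleGraph.IsTree.eq_of_adj_of_dist_eq {V : Type*} {T : SimpleGraph V} (hT : T.IsTree)
    {r a b c : V} (hab : T.Adj a b) (hac : T.Adj a c) (hb : T.dist r a = T.dist r b + 1)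
    (hc : T.dist r a = T.dist r c + 1) : b = c := by
  have key : ∀ d, T.Adj a d → T.dist r a = T.dist r d + 1 →
      ∃ p : T.Walk r a, p.IsPath ∧ p.penultimate = d := by
    intro d had hd
    obtain ⟨p, hp⟩ := hT.connected.exists_walk_length_eq_dist r d
    -- A geodesic to `d` followed by the edge to `a` is again a geodesic, hence the unique path from
    -- `r` to `a`.
    refine ⟨p.concat had.symm, ?_, by simp⟩
    exact SimpleGraph.Walk.isPath_of_length_eq_dist _ (by simp [hp, hd])
  obtain ⟨p, hp, hpb⟩ := key b hab hb
  obtain ⟨q, hq, hqc⟩ := key c hac hc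
  rw [← hpb, ← hqc, hT.existsUnique_path r a |>.unique hp hq]

theorem eq_of_mem_inArborescences {V : Type u} {G : InfluenceGraph V}
    (hG : G ∈ inArborescences V) {a b c : V} (hb : (a, b) ∈ G.E) (hc : (a, c) ∈ G.E) : b = c := by
  obtain ⟨T, r, hT, hE⟩ := hG
  obtain ⟨hab, hdb⟩ := (hE a b).1 hb
  obtain ⟨hac, hdc⟩ := (hE a c).1 hc
  exact hT.eq_of_adj_of_dist_eq hab hac hdb hdc

theorem two_div_one_sub_pow_le {k : ℕ} (hk : 2 ≤ k) :
    2 / (1 - (1 - 2 / (k : ℝ)) ^ k) ≤ 2 * Real.exp 1 ^ 2 / (Real.exp 1 ^ 2 - 1) := by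
  have h : (1 - 2 / (k : ℝ)) ^ k ≤ Real.exp (-2) :=
    Real.one_sub_div_pow_le_exp_neg (by exact_mod_cast hk)
  have he : 1 < Real.exp 1 ^ 2 := one_lt_pow₀ (by simp) two_ne_zero
  have hexp : Real.exp (-2) = (Real.exp 1 ^ 2)⁻¹ := by
    rw [Real.exp_neg, ← Real.exp_nat_mul]
    norm_num
  rw [hexp] at h
  have hlt : (Real.exp 1 ^ 2)⁻¹ < 1 := inv_lt_one_of_one_lt₀ he
  calc 2 / (1 - (1 - 2 / (k : ℝ)) ^ k) ≤ 2 / (1 - (Real.exp 1 ^ 2)⁻¹) :=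
        div_le_div_of_nonneg_left two_pos.le (by linarith) (by linarith)
    _ = 2 * Real.exp 1 ^ 2 / (Real.exp 1 ^ 2 - 1) := by
        have : Real.exp 1 ^ 2 - 1 ≠ 0 := by linarith
        field_simp

theorem theorem3p1 (k : ℕ) (hk : 2 ≤ k) :
    kAdaptivityGap.{u} inArborescences k ≤ ((2 / (1 - (1 - 2 / (k : ℝ)) ^ k) : ℝ) : EReal) ∧
    2 / (1 - (1 - 2 / (k : ℝ)) ^ k) ≤ 2 * Real.exp 1 ^ 2 / (Real.exp 1 ^ 2 - 1) ∧
    |2 * Real.exp 1 ^ 2 / (Real.exp 1 ^ 2 - 1) - 2.31| < 0.005 ∧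
    2 * Real.exp 1 ^ 2 / (Real.exp 1 ^ 2 - 1) < 2 * Real.exp 1 / (Real.exp 1 - 1) := by
  have hl : 2.718 < Real.exp 1 := by linarith [Real.exp_one_gt_d9]
  have hu : Real.exp 1 < 2.719 := by linarith [Real.exp_one_lt_d9]
  have hpos : 0 < Real.exp 1 ^ 2 - 1 := by nlinarith
  refine ⟨?_, two_div_one_sub_pow_le hk, ?_, ?_⟩
  · refine iSup_le fun V => iSup_le fun _ => iSup_le fun G => iSup_le fun hG =>
      iSup_le fun hV => EReal.coe_le_coe_iff.2 ?_
    exact InfluenceGraph.optA_div_optN_le hk hV fun a b c => eq_of_mem_inArborescences hG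
  · rw [abs_sub_lt_iff, sub_lt_iff_lt_add, sub_lt_comm, div_lt_iff₀ hpos, lt_div_iff₀ hpos]
    constructor <;> nlinarith
  -- After cancelling 2e(e - 1) this is e < e + 1.
  · rw [div_lt_div_iff₀ hpos (by linarith)]
    nlinarith
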